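/- Theorem 2.1. Let $\widetilde G \rightrightarrows P$ be a $2d$-dimensional symplectic groupoid: $\widetilde G$ and $P$ are smooth manifolds with $\dim \widetilde G = 2d$; $\widetilde G \rightrightarrows P$ is a groupoid with source $\widetilde\alpha$, target $\widetilde\beta$ and multiplication $\widetilde m(g,h)=gh$ defined on $\widetilde G_2=\{(g,h)\in\widetilde G\times\widetilde G : \widetilde\beta(g)=\widetilde\alpha(h)\}$, such that $\widetilde\alpha,\widetilde\beta\colon\widetilde G\to P$ are submersions and $\widetilde m\colon\widetilde G_2\to\widetilde G$ is smooth; $\widetilde\omega$ is a symplectic form on $\widetilde G$; and the graph $\{(g,h,gh) : (g,h)\in\widetilde G_2\}$ is a Lagrangian submanifold of $\widetilde G^-\times\widetilde G^-\times\widetilde G$, where $\widetilde G^-=(\widetilde G,-\widetilde\omega)$. Let $\Sigma\subset\widetilde G$ be a (possibly only immersed) Lagrangian submanifold. Then the restricted source map $\widetilde\alpha|_\Sigma\colon\Sigma\to P$ is a local diffeomorphism if and only if the restricted target map $\widetilde\beta|_\Sigma\colon\Sigma\to P$ is a local diffeomorphism. -/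

import Mathlib

open scoped Manifold ContDiff

namespace SymplecticGroupoid

noncomputable section

/-- A (not necessarily continuous) differential two-form on `M`: an alternating bilinear form on
each tangent space. -/
abbrev TwoForm {E H : Type*} [NormedAddCommGroup E] [NormedSpace ℝ E] [TopologicalSpace H]
    (I : ModelWithCorners ℝ E H) (M : Type*) [TopologicalSpace M] [ChartedSpace H M] :=
  ∀ x : M, TangentSpace I x [⋀^Fin 2]→L[ℝ] ℝ

/-- The pullback `f^* Ω`, that is `(f^* Ω)_x (u, v) = Ω_{f x} (T_x f u, T_x f v)`. -/
def TwoForm.pullback {E H E' H' : Type*}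
    [NormedAddCommGroup E] [NormedSpace ℝ E] [TopologicalSpace H]
    [NormedAddCommGroup E'] [NormedSpace ℝ E'] [TopologicalSpace H']
    (I : ModelWithCorners ℝ E H) (J : ModelWithCorners ℝ E' H')
    {M N : Type*} [TopologicalSpace M] [ChartedSpace H M] [TopologicalSpace N] [ChartedSpace H' N]
    (f : M → N) (Ω : TwoForm J N) : TwoForm I M :=
  fun x => (Ω (f x)).compContinuousLinearMap (mfderiv I J f x)

/-- The expression of a two-form in a chart `e`: the pullback under `e⁻¹`, a two-form on the model
space. Only its values on `e.target` are meaningful. -/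
def TwoForm.inChart {E : Type*} [NormedAddCommGroup E] [NormedSpace ℝ E]
    {M : Type*} [TopologicalSpace M] [ChartedSpace E M]
    (Ω : TwoForm 𝓘(ℝ, E) M) (e : OpenPartialHomeomorph M E) : E → E [⋀^Fin 2]→L[ℝ] ℝ :=
  fun y => TwoForm.pullback 𝓘(ℝ, E) 𝓘(ℝ, E) e.symm Ω y

/-- A symplectic form: a smooth, closed, nondegenerate two-form. Smoothness and closedness are
expressed in the charts of the atlas. -/
structure IsSymplectic {E : Type*} [NormedAddCommGroup E] [NormedSpace ℝ E]
    {M : Type*} [TopologicalSpace M] [ChartedSpace E M] (Ω : TwoForm 𝓘(ℝ, E) M) : Prop where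
  smooth : ∀ e ∈ atlas E M, ContDiffOn ℝ ∞ (Ω.inChart e) e.target
  closed : ∀ e ∈ atlas E M, ∀ y ∈ e.target, extDeriv (Ω.inChart e) y = 0
  nondegenerate : ∀ (x : M) (v : TangentSpace 𝓘(ℝ, E) x),
    (∀ w : TangentSpace 𝓘(ℝ, E) x, Ω x ![v, w] = 0) → v = 0

/-- A smooth map `ι : S → M` (thought of as an immersion) is Lagrangian for `Ω` if at each point
the tangent space `W = range (T_s ι)` equals its `Ω`-orthogonal complement `W^Ω`. -/
def IsLagrangianMap {E H V K : Type*}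
    [NormedAddCommGroup E] [NormedSpace ℝ E] [TopologicalSpace H]
    [NormedAddCommGroup V] [NormedSpace ℝ V] [TopologicalSpace K]
    (J : ModelWithCorners ℝ V K) (I : ModelWithCorners ℝ E H)
    {S M : Type*} [TopologicalSpace S] [ChartedSpace K S] [TopologicalSpace M] [ChartedSpace H M]
    (Ω : TwoForm I M) (ι : S → M) : Prop :=
  ∀ (s : S) (v : TangentSpace I (ι s)),
    v ∈ Set.range (mfderiv J I ι s) ↔ ∀ u ∈ Set.range (mfderiv J I ι s), Ω (ι s) ![u, v] = 0

/-- The manifold `S`, with inclusion `ι : S → M`, is an (immersed) Lagrangian submanifold of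
`(M, Ω)`. If `ι` is moreover a topological embedding, it is an embedded one. -/
structure IsLagrangianSubmanifold {E H V K : Type*}
    [NormedAddCommGroup E] [NormedSpace ℝ E] [TopologicalSpace H]
    [NormedAddCommGroup V] [NormedSpace ℝ V] [TopologicalSpace K]
    (J : ModelWithCorners ℝ V K) (I : ModelWithCorners ℝ E H)
    {S M : Type*} [TopologicalSpace S] [ChartedSpace K S] [TopologicalSpace M] [ChartedSpace H M]
    (Ω : TwoForm I M) (ι : S → M) : Prop where
  injective : Function.Injective ι
  immersion : Manifold.IsImmersion J I ∞ ι
  lagrangian : IsLagrangianMap J I Ω ι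

/-- The subset `Γ` of `M`, with the subspace topology, is an embedded Lagrangian submanifold of
`(M, Ω)`. (The smooth structure making the inclusion an immersion is then unique.) -/
def IsLagrangianSubset {E H : Type*} [NormedAddCommGroup E] [NormedSpace ℝ E] [TopologicalSpace H]
    (I : ModelWithCorners ℝ E H) {M : Type*} [TopologicalSpace M] [ChartedSpace H M]
    (Ω : TwoForm I M) (Γ : Set M) : Prop :=
  ∃ (n : ℕ) (_ : ChartedSpace (EuclideanSpace ℝ (Fin n)) Γ),
    IsManifold (𝓡 n) ∞ Γ ∧ IsLagrangianSubmanifold (𝓡 n) I Ω (Subtype.val : Γ → M)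

/-- A groupoid `G ⇉ P` with set of arrows `G` and set of objects `P`. The product `mul g h` is
meaningful only when `β g = α h`; its other values are irrelevant. -/
structure GroupoidOver (G P : Type*) where
  /-- the source map -/
  α : G → P
  /-- the target map -/
  β : G → P
  /-- the multiplication, on composable pairs -/
  mul : G → G → G
  /-- the identity section -/
  ε : P → G
  /-- the inversion -/
  inv : G → G
  α_mul : ∀ g h, β g = α h → α (mul g h) = α g
  β_mul : ∀ g h, β g = α h → β (mul g h) = β h
  mul_assoc : ∀ g h k, β g = α h → β h = α k → mul (mul g h) k = mul g (mul h k)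
  α_ε : ∀ p, α (ε p) = p
  β_ε : ∀ p, β (ε p) = p
  ε_mul : ∀ g, mul (ε (α g)) g = g
  mul_ε : ∀ g, mul g (ε (β g)) = g
  α_inv : ∀ g, α (inv g) = β g
  β_inv : ∀ g, β (inv g) = α g
  mul_inv : ∀ g, mul g (inv g) = ε (α g)
  inv_mul : ∀ g, mul (inv g) g = ε (β g)

/-- The set `G₂ ⊆ G × G` of composable pairs. -/
def GroupoidOver.composable {G P : Type*} (𝒢 : GroupoidOver G P) : Set (G × G) :=
  {p | 𝒢.β p.1 = 𝒢.α p.2}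

/-- The graph `{(g, h, gh)} ⊆ G × G × G` of the multiplication `G₂ → G`. -/
def GroupoidOver.mulGraph {G P : Type*} (𝒢 : GroupoidOver G P) : Set (G × G × G) :=
  {p | 𝒢.β p.1 = 𝒢.α p.2.1 ∧ p.2.2 = 𝒢.mul p.1 p.2.1}

/-- A Lie groupoid: source and target are submersions, and the multiplication is smooth on the
submanifold `G₂` of `G × G`. -/
structure IsLieGroupoid {E F : Type*}
    [NormedAddCommGroup E] [NormedSpace ℝ E] [NormedAddCommGroup F] [NormedSpace ℝ F]
    {G P : Type*} [TopologicalSpace G] [ChartedSpace E G] [TopologicalSpace P] [ChartedSpace F P]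
    (𝒢 : GroupoidOver G P) : Prop where
  submersion_α : Manifold.IsSubmersion 𝓘(ℝ, E) 𝓘(ℝ, F) ∞ 𝒢.α
  submersion_β : Manifold.IsSubmersion 𝓘(ℝ, E) 𝓘(ℝ, F) ∞ 𝒢.β
  smooth_mul : ContMDiffOn (𝓘(ℝ, E).prod 𝓘(ℝ, E)) 𝓘(ℝ, E) ∞
    (fun p : G × G => 𝒢.mul p.1 p.2) 𝒢.composable

/-- The two-form `-pr₁^* Ω - pr₂^* Ω + pr₃^* Ω` of `G⁻ × G⁻ × G`. -/
def TwoForm.twisted {E : Type*} [NormedAddCommGroup E] [NormedSpace ℝ E]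
    {G : Type*} [TopologicalSpace G] [ChartedSpace E G] (Ω : TwoForm 𝓘(ℝ, E) G) :
    TwoForm (𝓘(ℝ, E).prod (𝓘(ℝ, E).prod 𝓘(ℝ, E))) (G × G × G) :=
  fun p =>
    - TwoForm.pullback (𝓘(ℝ, E).prod (𝓘(ℝ, E).prod 𝓘(ℝ, E))) 𝓘(ℝ, E)
        (fun q : G × G × G => q.1) Ω p
    - TwoForm.pullback (𝓘(ℝ, E).prod (𝓘(ℝ, E).prod 𝓘(ℝ, E))) 𝓘(ℝ, E)
        (fun q : G × G × G => q.2.1) Ω p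
    + TwoForm.pullback (𝓘(ℝ, E).prod (𝓘(ℝ, E).prod 𝓘(ℝ, E))) 𝓘(ℝ, E)
        (fun q : G × G × G => q.2.2) Ω p

/-- A symplectic groupoid: a Lie groupoid `G ⇉ P` with a symplectic form `Ω` on `G` such that the
graph of the multiplication is a Lagrangian submanifold of `G⁻ × G⁻ × G`. -/
structure IsSymplecticGroupoid {E F : Type*}
    [NormedAddCommGroup E] [NormedSpace ℝ E] [NormedAddCommGroup F] [NormedSpace ℝ F]
    {G P : Type*} [TopologicalSpace G] [ChartedSpace E G] [TopologicalSpace P] [ChartedSpace F P]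
    (𝒢 : GroupoidOver G P) (Ω : TwoForm 𝓘(ℝ, E) G) : Prop where
  lie : IsLieGroupoid (E := E) (F := F) 𝒢
  symplectic : IsSymplectic Ω
  lagrangian_graph :
    IsLagrangianSubset (𝓘(ℝ, E).prod (𝓘(ℝ, E).prod 𝓘(ℝ, E))) Ω.twisted 𝒢.mulGraph

end

end SymplecticGroupoid

open scoped Topology
open Set

namespace SymplecticGroupoid

/-! The heart of the matter is that `ker Tβ` and `ker Tα` are `Ω`-orthogonal at every arrow `g`
(`IsSymplecticGroupoid.apply_eq_zero`). For `u` in the first and `v` in the second, the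
multiplication graph has tangent vectors `(u, 0, u)` and `(0, w, v)` at `(g, ε (β g), g)`. The
twisted form vanishes on this pair, and only its last term `Ω(u, v)` survives.

Suppose now that `α ∘ ι` is a local diffeomorphism. Then `TG = ker Tα + TΣ` along `Σ`. A vector of
`TΣ ∩ ker Tβ` is orthogonal to `ker Tα` by the above and to `TΣ` because `Σ` is Lagrangian, so it is
zero by nondegeneracy. Thus `T(β ∘ ι)` is injective, hence bijective since the dimensions agree, and
the inverse function theorem applies. The argument is symmetric in `α` and `β`
(`IsLagrangianSubmanifold.isLocalDiffeomorph_comp`). -/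

/-! ### Inverse function theorem -/

/-- The inverse function theorem on an open set: a function that is `C^n` on an open set `U`, with
invertible derivative at `x ∈ U`, restricts to a partial diffeomorphism with source in `U`. -/
theorem exists_partialDiffeomorph_of_hasFDerivAt {V F : Type*}
    [NormedAddCommGroup V] [NormedSpace ℝ V] [CompleteSpace V]
    [NormedAddCommGroup F] [NormedSpace ℝ F] {n : WithTop ℕ∞} (hn : n ≠ 0)
    {f : V → F} {U : Set V} (hU : IsOpen U) {x : V} (hx : x ∈ U) (hf : ContDiffOn ℝ n f U)
    {f' : V ≃L[ℝ] F} (hf' : HasFDerivAt f (f' : V →L[ℝ] F) x) :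
    ∃ Φ : PartialDiffeomorph 𝓘(ℝ, V) 𝓘(ℝ, F) V F n,
      x ∈ Φ.source ∧ Φ.source ⊆ U ∧ EqOn f Φ Φ.source := by
  have hfx : ContDiffAt ℝ n f x := hf.contDiffAt (hU.mem_nhds hx)
  set e := hfx.toOpenPartialHomeomorph f hf' hn
  -- The local inverse is `C^n` at the image of a point where the derivative is invertible; such
  -- points form an open set, to which the source is shrunk.
  set W := U ∩ fderiv ℝ f ⁻¹' range ((↑) : (V ≃L[ℝ] F) → (V →L[ℝ] F))
  have hWo : IsOpen W :=
    (hf.continuousOn_fderiv_of_isOpen hU (ENat.one_le_iff_ne_zero_withTop.2 hn)).isOpen_inter_preimage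
      hU ContinuousLinearEquiv.isOpen
  set e' := e.restrOpen W hWo
  have hsrc : e'.source = e.source ∩ W := e.restrOpen_source W hWo
  have hat : ∀ y ∈ e'.source, ContDiffAt ℝ n f y := fun y hy ↦
    hf.contDiffAt (hU.mem_nhds (hsrc ▸ hy).2.1)
  refine ⟨{ toPartialEquiv := e'.toPartialEquiv
            open_source := e'.open_source
            open_target := e'.open_target
            contMDiffOn_toFun := fun y hy ↦ (hat y hy).contMDiffAt.contMDiffWithinAt
            contMDiffOn_invFun := fun y hy ↦ ?_ }, ?_, ?_, fun y _ ↦ rfl⟩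
  · have hy' : e'.symm y ∈ e'.source := e'.map_target hy
    obtain ⟨A, hA⟩ := (hsrc ▸ hy').2.2
    have hd : HasFDerivAt e' (A : V →L[ℝ] F) (e'.symm y) := by
      rw [hA]
      exact ((hat _ hy').differentiableAt hn).hasFDerivAt
    exact (e'.contDiffAt_symm hy hd (hat _ hy')).contMDiffAt.contMDiffWithinAt
  · change x ∈ e'.source
    rw [hsrc]
    exact ⟨hfx.mem_toOpenPartialHomeomorph_source hf' hn, hx, f', hf'.fderiv.symm⟩
  · change e'.source ⊆ U
    rw [hsrc]
    exact fun y hy ↦ hy.2.1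

/-- A chart, as a partial diffeomorphism. -/
noncomputable def chartPartialDiffeomorph {V : Type*} [NormedAddCommGroup V] [NormedSpace ℝ V]
    {M : Type*} [TopologicalSpace M] [ChartedSpace V M] (n : WithTop ℕ∞)
    [IsManifold 𝓘(ℝ, V) n M] (x : M) : PartialDiffeomorph 𝓘(ℝ, V) 𝓘(ℝ, V) M V n where
  toPartialEquiv := (chartAt V x).toPartialEquiv
  open_source := (chartAt V x).open_source
  open_target := (chartAt V x).open_target
  contMDiffOn_toFun := contMDiffOn_chart
  contMDiffOn_invFun := contMDiffOn_chart_symm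

/-- The inverse function theorem on manifolds. -/
theorem isLocalDiffeomorphAt_of_bijective_mfderiv {V F : Type*}
    [NormedAddCommGroup V] [NormedSpace ℝ V] [CompleteSpace V]
    [NormedAddCommGroup F] [NormedSpace ℝ F] [CompleteSpace F] {n : WithTop ℕ∞} (hn : n ≠ 0)
    {M : Type*} [TopologicalSpace M] [ChartedSpace V M] [IsManifold 𝓘(ℝ, V) n M]
    {N : Type*} [TopologicalSpace N] [ChartedSpace F N] [IsManifold 𝓘(ℝ, F) n N]
    {f : M → N} (hf : ContMDiff 𝓘(ℝ, V) 𝓘(ℝ, F) n f) {x : M}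
    (hx : Function.Bijective (mfderiv 𝓘(ℝ, V) 𝓘(ℝ, F) f x)) :
    IsLocalDiffeomorphAt 𝓘(ℝ, V) 𝓘(ℝ, F) n f x := by
  set φ := chartAt V x
  set ψ := chartAt F (f x)
  set g : V → F := ψ ∘ f ∘ φ.symm
  set U : Set V := φ.target ∩ φ.symm ⁻¹' (f ⁻¹' ψ.source)
  have hxφ : x ∈ φ.source := mem_chart_source V x
  have hfxψ : f x ∈ ψ.source := mem_chart_source F (f x)
  have hUo : IsOpen U :=
    φ.isOpen_inter_preimage_symm (ψ.open_source.preimage hf.continuous)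
  have hxU : φ x ∈ U := ⟨φ.map_source hxφ, by simpa [φ.left_inv hxφ] using hfxψ⟩
  have hgU : ContMDiffOn 𝓘(ℝ, V) 𝓘(ℝ, F) n g U :=
    (contMDiffOn_chart (I := 𝓘(ℝ, F)) (x := f x)).comp
      (hf.comp_contMDiffOn ((contMDiffOn_chart_symm (I := 𝓘(ℝ, V)) (x := x)).mono
        inter_subset_left)) fun y hy ↦ hy.2
  have hgx : MDifferentiableAt 𝓘(ℝ, V) 𝓘(ℝ, F) g (φ x) :=
    (hgU.contMDiffAt (hUo.mem_nhds hxU)).mdifferentiableAt hn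
  have hone : (1 : WithTop ℕ∞) ≤ n := ENat.one_le_iff_ne_zero_withTop.2 hn
  have : IsManifold 𝓘(ℝ, V) 1 M := IsManifold.of_le hone
  have : IsManifold 𝓘(ℝ, F) 1 N := IsManifold.of_le hone
  have hφd := mdifferentiable_chart (I := 𝓘(ℝ, V)) x
  have hψd := mdifferentiable_chart (I := 𝓘(ℝ, F)) (f x)
  have hbij : Function.Bijective (fderiv ℝ g (φ x)) := by
    rw [← mfderiv_eq_fderiv]
    -- The chain rule on both sides conjugates the derivative of `g` to that of `f` by the
    -- invertible chart derivatives.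
    have heq : g ∘ φ =ᶠ[𝓝 x] ψ ∘ f := by
      filter_upwards [φ.open_source.mem_nhds hxφ] with y hy
      simp [g, φ.left_inv hy]
    have h1 := heq.mfderiv_eq (I := 𝓘(ℝ, V)) (I' := 𝓘(ℝ, F))
    rw [mfderiv_comp x hgx (hφd.mdifferentiableAt hxφ)] at h1
    have h2 := mfderiv_comp x (hψd.mdifferentiableAt hfxψ) (hf.contMDiffAt.mdifferentiableAt hn)
    have h3 : ⇑(mfderiv 𝓘(ℝ, V) 𝓘(ℝ, F) g (φ x)) ∘ ⇑(mfderiv 𝓘(ℝ, V) 𝓘(ℝ, V) φ x) =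
        ⇑(mfderiv 𝓘(ℝ, F) 𝓘(ℝ, F) ψ (f x)) ∘ ⇑(mfderiv 𝓘(ℝ, V) 𝓘(ℝ, F) f x) :=
      congrArg (fun A : V →L[ℝ] F ↦ (A : V → F)) (h1.trans h2)
    refine (Function.Bijective.of_comp_iff _ (hφd.mfderiv_bijective hxφ)).1 ?_
    refine h3 ▸ ?_
    exact (hψd.mfderiv_bijective hfxψ).comp hx
  have hgd : HasFDerivAt g
      (ContinuousLinearEquiv.ofBijective (fderiv ℝ g (φ x)) (LinearMap.ker_eq_bot.2 hbij.1)
        (LinearMap.range_eq_top.2 hbij.2) : V →L[ℝ] F) (φ x) := by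
    rw [ContinuousLinearEquiv.coe_ofBijective]
    exact (mdifferentiableAt_iff_differentiableAt.1 hgx).hasFDerivAt
  obtain ⟨Φ, hxΦ, hΦU, hΦ⟩ :=
    exists_partialDiffeomorph_of_hasFDerivAt hn hUo hxU hgU.contDiffOn hgd
  have key : ∀ y ∈ φ.source, φ y ∈ Φ.source → Φ (φ y) = ψ (f y) ∧ f y ∈ ψ.source := by
    intro y hy hyΦ
    refine ⟨?_, by simpa [φ.left_inv hy] using (hΦU hyΦ).2⟩
    rw [← hΦ hyΦ]
    simp [g, φ.left_inv hy]
  refine ⟨((chartPartialDiffeomorph n x).trans Φ).trans (chartPartialDiffeomorph n (f x)).symm,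
    ⟨⟨hxφ, hxΦ⟩, ?_⟩, fun y hy ↦ ?_⟩
  · change Φ (φ x) ∈ ψ.target
    rw [(key x hxφ hxΦ).1]
    exact ψ.map_source hfxψ
  · have hy' := key y hy.1.1 hy.1.2
    change f y = ψ.symm (Φ (φ y))
    rw [hy'.1, ψ.left_inv hy'.2]

/-! ### Tangent vectors as velocities of curves -/

/-- The derivative of a smooth curve with values in an embedded submanifold is tangent to the
submanifold. -/
theorem exists_mfderiv_val_eq_of_eventually_mem {E H V K : Type*}
    [NormedAddCommGroup E] [NormedSpace ℝ E] [TopologicalSpace H]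
    [NormedAddCommGroup V] [NormedSpace ℝ V] [TopologicalSpace K]
    {J : ModelWithCorners ℝ V K} {I : ModelWithCorners ℝ E H}
    {M : Type*} [TopologicalSpace M] [ChartedSpace H M] [IsManifold I ∞ M]
    {Γ : Set M} [ChartedSpace K Γ] [IsManifold J ∞ Γ]
    (hΓ : Manifold.IsImmersion J I ∞ (Subtype.val : Γ → M)) {c : ℝ → M} {x : Γ} (hx : c 0 = x)
    (hc : ContMDiffAt 𝓘(ℝ, ℝ) I ∞ c 0) (hcΓ : ∀ᶠ t in 𝓝 (0 : ℝ), c t ∈ Γ) {v : E}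
    (hv : HasMFDerivAt 𝓘(ℝ, ℝ) I c 0 (ContinuousLinearMap.toSpanSingleton ℝ v : ℝ →L[ℝ] E)) :
    ∃ w : TangentSpace J x, mfderiv J I (Subtype.val : Γ → M) x w = v := by
  classical
  -- The lift of `c` to `Γ`; the default value `x` occurs only away from `0`.
  set b : ℝ → Γ := fun t ↦ if h : c t ∈ Γ then ⟨c t, h⟩ else x
  have hbc : Subtype.val ∘ b =ᶠ[𝓝 0] c := by
    filter_upwards [hcΓ] with t ht
    simp [b, ht]
  have hb0 : b 0 = x := Subtype.ext (hbc.eq_of_nhds.trans hx)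
  have hbcont : ContinuousAt b 0 := by
    rw [Topology.IsInducing.subtypeVal.continuousAt_iff]
    exact hc.continuousAt.congr hbc.symm
  -- A continuous lift through an immersion is smooth. Continuity comes from the subspace topology
  -- on `Γ`.
  have hbs : ContMDiffAt 𝓘(ℝ, ℝ) J ∞ b 0 :=
    (ContMDiffAt.iff_comp_isImmersionAt (hΓ.isImmersionAt _)).2
      ⟨hbcont, hc.congr_of_eventuallyEq hbc⟩
  have hbd := (hbs.mdifferentiableAt (by simp)).hasMFDerivAt
  have hval : HasMFDerivAt J I (Subtype.val : Γ → M) (b 0)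
      (mfderiv J I (Subtype.val : Γ → M) (b 0)) :=
    ((hΓ.contMDiff _).mdifferentiableAt (by simp)).hasMFDerivAt
  have h := hasMFDerivAt_unique (hv.congr_of_eventuallyEq hbc) (hval.comp 0 hbd)
  have h1 := congrArg (fun A : ℝ →L[ℝ] E ↦ A 1) h
  rw [← hb0]
  refine ⟨mfderiv 𝓘(ℝ, ℝ) J b 0 (1 : ℝ), ?_⟩
  refine (h1.symm.trans ?_)
  exact one_smul ℝ v

/-- Every vector in the kernel of the derivative of a submersion is the velocity of a smooth curve
in the fibre. -/
theorem exists_curve_of_mfderiv_eq_zero {E F : Type*}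
    [NormedAddCommGroup E] [NormedSpace ℝ E] [NormedAddCommGroup F] [NormedSpace ℝ F]
    {M N : Type*} [TopologicalSpace M] [ChartedSpace E M] [IsManifold 𝓘(ℝ, E) ∞ M]
    [TopologicalSpace N] [ChartedSpace F N] [IsManifold 𝓘(ℝ, F) ∞ N]
    {f : M → N} {x : M} (hf : Manifold.IsSubmersionAt 𝓘(ℝ, E) 𝓘(ℝ, F) ∞ f x)
    {u : TangentSpace 𝓘(ℝ, E) x} (hu : mfderiv 𝓘(ℝ, E) 𝓘(ℝ, F) f x u = 0) :
    ∃ c : ℝ → M, c 0 = x ∧ ContMDiffAt 𝓘(ℝ, ℝ) 𝓘(ℝ, E) ∞ c 0 ∧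
      HasMFDerivAt 𝓘(ℝ, ℝ) 𝓘(ℝ, E) c 0
        (ContinuousLinearMap.toSpanSingleton ℝ (show E from u) : ℝ →L[ℝ] E) ∧
      ∀ᶠ t in 𝓝 (0 : ℝ), f (c t) = f x := by
  set φ := hf.domChart
  set ψ := hf.codChart
  have hxφ : x ∈ φ.source := hf.mem_domChart_source
  have hfxψ : f x ∈ ψ.source := hf.mem_codChart_source
  have hφ : φ.MDifferentiable 𝓘(ℝ, E) 𝓘(ℝ, E) :=
    ⟨(contMDiffOn_of_mem_maximalAtlas hf.domChart_mem_maximalAtlas).mdifferentiableOn (by simp),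
      (contMDiffOn_symm_of_mem_maximalAtlas hf.domChart_mem_maximalAtlas).mdifferentiableOn
        (by simp)⟩
  have hwritten : ∀ y ∈ φ.target, ψ (f (φ.symm y)) = (hf.equiv y).1 := fun y hy ↦ by
    have hy' : y ∈ (φ.extend 𝓘(ℝ, E)).target := by simpa using hy
    simpa using hf.writtenInCharts hy'
  set a : E := mfderiv 𝓘(ℝ, E) 𝓘(ℝ, E) φ x u
  -- In submersion charts `f` is the linear projection `p`, so a straight line with direction in
  -- `ker p` stays in the fibre.
  set p : E →L[ℝ] F := (ContinuousLinearMap.fst ℝ F hf.complement).comp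
    (hf.equiv : E →L[ℝ] F × hf.complement)
  have hpa : p a = 0 := by
    have heq : ψ ∘ f =ᶠ[𝓝 x] p ∘ φ := by
      filter_upwards [φ.open_source.mem_nhds hxφ] with y hy
      have := hwritten (φ y) (φ.map_source hy)
      rwa [φ.left_inv hy] at this
    have h1 := heq.mfderiv_eq (I := 𝓘(ℝ, E)) (I' := 𝓘(ℝ, F))
    have hψ : MDifferentiableAt 𝓘(ℝ, F) 𝓘(ℝ, F) ψ (f x) :=
      (contMDiffAt_of_mem_maximalAtlas hf.codChart_mem_maximalAtlas hfxψ).mdifferentiableAt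
        (by simp)
    rw [mfderiv_comp x hψ (hf.contMDiffAt.mdifferentiableAt (by simp)),
      mfderiv_comp x p.mdifferentiableAt (hφ.mdifferentiableAt hxφ),
      ContinuousLinearMap.mfderiv_eq] at h1
    have h2 := congrArg (fun A : E →L[ℝ] F ↦ A u) h1
    refine h2.symm.trans ?_
    change mfderiv 𝓘(ℝ, F) 𝓘(ℝ, F) ψ (f x) (mfderiv 𝓘(ℝ, E) 𝓘(ℝ, F) f x u) = 0
    rw [hu]
    exact map_zero _
  set L : ℝ → E := fun t ↦ φ x + t • a
  have hL0 : L 0 = φ x := by simp [L]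
  have hLd : HasMFDerivAt 𝓘(ℝ, ℝ) 𝓘(ℝ, E) L 0 (ContinuousLinearMap.toSpanSingleton ℝ a) :=
    ((ContinuousLinearMap.toSpanSingleton ℝ a).hasFDerivAt.const_add (φ x)).hasMFDerivAt
  have hLs : ContMDiff 𝓘(ℝ, ℝ) 𝓘(ℝ, E) ∞ L :=
    (contDiff_const.add (contDiff_id.smul contDiff_const)).contMDiff
  have hsymm : ContMDiffAt 𝓘(ℝ, E) 𝓘(ℝ, E) ∞ φ.symm (φ x) :=
    contMDiffAt_symm_of_mem_maximalAtlas hf.domChart_mem_maximalAtlas (φ.map_source hxφ)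
  have hsymmd : HasMFDerivAt 𝓘(ℝ, E) 𝓘(ℝ, E) φ.symm (φ x)
      (mfderiv 𝓘(ℝ, E) 𝓘(ℝ, E) φ.symm (φ x)) :=
    (hφ.mdifferentiableAt_symm (φ.map_source hxφ)).hasMFDerivAt
  refine ⟨φ.symm ∘ L, ?_, hsymm.comp_of_eq hLs.contMDiffAt hL0, ?_, ?_⟩
  · simp [hL0, φ.left_inv hxφ]
  · rw [← hL0] at hsymmd
    refine (hsymmd.comp 0 hLd).congr_mfderiv ?_
    refine ContinuousLinearMap.ext_ring ?_
    have h3 := congrArg (fun A : E →L[ℝ] E ↦ A u) (hφ.symm_comp_deriv hxφ)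
    rw [hL0]
    change mfderiv 𝓘(ℝ, E) 𝓘(ℝ, E) φ.symm (φ x) ((1 : ℝ) • a) = (1 : ℝ) • (show E from u)
    rw [one_smul, one_smul]
    exact h3
  · have hev : ∀ᶠ t in 𝓝 (0 : ℝ), L t ∈ φ.target ∧ φ.symm (L t) ∈ f ⁻¹' ψ.source := by
      have hcont : ContinuousAt L 0 := hLs.continuous.continuousAt
      have ht : φ.target ∈ 𝓝 (L 0) := hL0 ▸ φ.open_target.mem_nhds (φ.map_source hxφ)
      filter_upwards [hcont ht] with t ht
      exact ⟨ht, hf.source_subset_preimage_source (φ.map_target ht)⟩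
    filter_upwards [hev] with t ht
    refine ψ.injOn ht.2 hfxψ ?_
    have h1 := hwritten _ ht.1
    have h2 := hwritten _ (φ.map_source hxφ)
    rw [φ.left_inv hxφ] at h2
    refine h1.trans (Eq.trans ?_ h2.symm)
    change p (φ x + t • a) = p (φ x)
    rw [map_add, map_smul, hpa, smul_zero, add_zero]

/-! ### Evaluation of two-forms -/

theorem TwoForm.pullback_apply {E H E' H' : Type*}
    [NormedAddCommGroup E] [NormedSpace ℝ E] [TopologicalSpace H]
    [NormedAddCommGroup E'] [NormedSpace ℝ E'] [TopologicalSpace H']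
    {I : ModelWithCorners ℝ E H} {J : ModelWithCorners ℝ E' H'}
    {M N : Type*} [TopologicalSpace M] [ChartedSpace H M] [TopologicalSpace N] [ChartedSpace H' N]
    (f : M → N) (Ω : TwoForm J N) (x : M) (a b : TangentSpace I x) :
    Ω.pullback I J f x ![a, b] = Ω (f x) ![mfderiv I J f x a, mfderiv I J f x b] := by
  change Ω (f x) (mfderiv I J f x ∘ ![a, b]) = _
  congr 1
  ext i
  fin_cases i <;> rfl

theorem TwoForm.swap {E H : Type*} [NormedAddCommGroup E] [NormedSpace ℝ E] [TopologicalSpace H]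
    {I : ModelWithCorners ℝ E H} {M : Type*} [TopologicalSpace M] [ChartedSpace H M]
    (Ω : TwoForm I M) (x : M) (a b : TangentSpace I x) : Ω x ![a, b] = -Ω x ![b, a] := by
  have h := (Ω x).toAlternatingMap.map_swap ![b, a] (i := 0) (j := 1) (by decide)
  refine Eq.trans ?_ h
  change Ω x ![a, b] = Ω x (![b, a] ∘ Equiv.swap 0 1)
  congr 1
  ext i
  fin_cases i <;> rfl

theorem TwoForm.twisted_apply {E : Type*} [NormedAddCommGroup E] [NormedSpace ℝ E]
    {G : Type*} [TopologicalSpace G] [ChartedSpace E G] (Ω : TwoForm 𝓘(ℝ, E) G) (g h k : G)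
    (a b : E × E × E) :
    Ω.twisted (g, h, k) ![a, b] =
      -Ω g ![a.1, b.1] - Ω h ![a.2.1, b.2.1] + Ω k ![a.2.2, b.2.2] := by
  set J := 𝓘(ℝ, E).prod (𝓘(ℝ, E).prod 𝓘(ℝ, E))
  have h1 := hasMFDerivAt_fst (I := 𝓘(ℝ, E)) (I' := 𝓘(ℝ, E).prod 𝓘(ℝ, E)) ((g, h, k) : G × G × G)
  have h2 := hasMFDerivAt_snd (I := 𝓘(ℝ, E)) (I' := 𝓘(ℝ, E).prod 𝓘(ℝ, E)) ((g, h, k) : G × G × G)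
  have h21 : HasMFDerivAt J 𝓘(ℝ, E) (fun q : G × G × G ↦ q.2.1) (g, h, k) _ :=
    (hasMFDerivAt_fst (I := 𝓘(ℝ, E)) (I' := 𝓘(ℝ, E)) ((h, k) : G × G)).comp (g, h, k) h2
  have h22 : HasMFDerivAt J 𝓘(ℝ, E) (fun q : G × G × G ↦ q.2.2) (g, h, k) _ :=
    (hasMFDerivAt_snd (I := 𝓘(ℝ, E)) (I' := 𝓘(ℝ, E)) ((h, k) : G × G)).comp (g, h, k) h2
  have e1 := Ω.pullback_apply (I := J) (fun q : G × G × G ↦ q.1) (g, h, k) a b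
  have e2 := Ω.pullback_apply (I := J) (fun q : G × G × G ↦ q.2.1) (g, h, k) a b
  have e3 := Ω.pullback_apply (I := J) (fun q : G × G × G ↦ q.2.2) (g, h, k) a b
  rw [h1.mfderiv] at e1
  rw [h21.mfderiv] at e2
  rw [h22.mfderiv] at e3
  exact congrArg₂ (· + ·) (congrArg₂ (· - ·) (congrArg Neg.neg e1) e2) e3

/-! ### Orthogonality of source and target fibres -/

/-- In a symplectic groupoid, the tangent spaces of the target fibres and of the source fibres are
symplectically orthogonal. -/
theorem IsSymplecticGroupoid.apply_eq_zero {E F : Type*}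
    [NormedAddCommGroup E] [NormedSpace ℝ E] [NormedAddCommGroup F] [NormedSpace ℝ F]
    {G : Type*} [TopologicalSpace G] [ChartedSpace E G] [IsManifold 𝓘(ℝ, E) ∞ G]
    {P : Type*} [TopologicalSpace P] [ChartedSpace F P] [IsManifold 𝓘(ℝ, F) ∞ P]
    {𝒢 : GroupoidOver G P} {Ω : TwoForm 𝓘(ℝ, E) G}
    (h𝒢 : IsSymplecticGroupoid (F := F) 𝒢 Ω) {g : G} {u v : TangentSpace 𝓘(ℝ, E) g}
    (hu : mfderiv 𝓘(ℝ, E) 𝓘(ℝ, F) 𝒢.β g u = 0) (hv : mfderiv 𝓘(ℝ, E) 𝓘(ℝ, F) 𝒢.α g v = 0) :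
    Ω g ![u, v] = 0 := by
  obtain ⟨n, _, _, hΓ⟩ := h𝒢.lagrangian_graph
  obtain ⟨a, ha0, has, had, haf⟩ :=
    exists_curve_of_mfderiv_eq_zero (h𝒢.lie.submersion_β.isSubmersionAt g) hu
  obtain ⟨b, hb0, hbs, hbd, hbf⟩ :=
    exists_curve_of_mfderiv_eq_zero (h𝒢.lie.submersion_α.isSubmersionAt g) hv
  have hp : (g, 𝒢.ε (𝒢.β g), g) ∈ 𝒢.mulGraph := ⟨(𝒢.α_ε _).symm, (𝒢.mul_ε g).symm⟩
  have hconst : ∀ y : G, HasMFDerivAt 𝓘(ℝ, ℝ) 𝓘(ℝ, E) (fun _ : ℝ ↦ y) 0 (0 : ℝ →L[ℝ] E) :=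
    fun y ↦ hasMFDerivAt_const y 0
  -- `β` is constant along `a`, so `ε (β g)` is a right unit for every `a t`; this gives the tangent
  -- vector `(u, 0, u)`.
  obtain ⟨w₁, hw₁⟩ := exists_mfderiv_val_eq_of_eventually_mem hΓ.immersion
    (c := fun t ↦ (a t, 𝒢.ε (𝒢.β g), a t)) (x := ⟨_, hp⟩) (by simp [ha0])
    (has.prodMk (contMDiffAt_const.prodMk has))
    (by
      filter_upwards [haf] with t ht
      refine ⟨ht.trans (𝒢.α_ε _).symm, ?_⟩
      change a t = 𝒢.mul (a t) (𝒢.ε (𝒢.β g))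
      rw [← ht, 𝒢.mul_ε])
    (v := ((show E from u), (0 : E), (show E from u)))
    ((had.prodMk ((hconst _).prodMk had)).congr_mfderiv 
      (ContinuousLinearMap.ext_ring
        (Prod.ext rfl (Prod.ext (smul_zero (1 : ℝ)).symm rfl))))
  have hinv : (𝒢.inv g, b 0) ∈ 𝒢.composable := by
    change 𝒢.β (𝒢.inv g) = 𝒢.α (b 0)
    rw [𝒢.β_inv, hb0]
  -- Left translation by `g⁻¹` moves `b` to a curve through `ε (β g)` with `g · m t = b t`; this
  -- gives the tangent vector `(0, w, v)` at the same point of the graph.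
  set m : ℝ → G := fun t ↦ 𝒢.mul (𝒢.inv g) (b t) with hm
  have hms : ContMDiffAt 𝓘(ℝ, ℝ) 𝓘(ℝ, E) ∞ m 0 := by
    -- Multiplication is smooth only within the composable pairs, but `(g⁻¹, b t)` is composable for
    -- all `t` near `0`.
    have hset : {t | 𝒢.α (b t) = 𝒢.α g} ∈ 𝓝 (0 : ℝ) := hbf
    refine ContMDiffWithinAt.contMDiffAt ?_ hset
    refine (h𝒢.lie.smooth_mul _ hinv).comp (f := fun t : ℝ ↦ (𝒢.inv g, b t)) (0 : ℝ)
      (contMDiffWithinAt_const.prodMk hbs.contMDiffWithinAt) fun t ht ↦ ?_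
    change 𝒢.β (𝒢.inv g) = 𝒢.α (b t)
    rw [𝒢.β_inv]
    exact ht.symm
  have hmd := (hms.mdifferentiableAt (by simp)).hasMFDerivAt
  obtain ⟨w₂, hw₂⟩ := exists_mfderiv_val_eq_of_eventually_mem hΓ.immersion
    (c := fun t ↦ (g, m t, b t)) (x := ⟨_, hp⟩) (by simp [hm, hb0, 𝒢.inv_mul])
    (contMDiffAt_const.prodMk (hms.prodMk hbs))
    (by
      filter_upwards [hbf] with t ht
      have hc : 𝒢.β (𝒢.inv g) = 𝒢.α (b t) := by rw [𝒢.β_inv, ht]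
      refine ⟨?_, ?_⟩
      · change 𝒢.β g = 𝒢.α (m t)
        rw [hm, 𝒢.α_mul _ _ hc, 𝒢.α_inv]
      · change b t = 𝒢.mul g (m t)
        rw [hm, ← 𝒢.mul_assoc _ _ _ (𝒢.α_inv g).symm hc, 𝒢.mul_inv, ← ht, 𝒢.ε_mul])
    (v := ((0 : E), (show E from mfderiv 𝓘(ℝ, ℝ) 𝓘(ℝ, E) m 0 (1 : ℝ)), (show E from v)))
    (((hconst _).prodMk (hmd.prodMk hbd)).congr_mfderiv 
      (ContinuousLinearMap.ext_ring
        (Prod.ext (smul_zero (A := E) (1 : ℝ)).symm (Prod.ext (one_smul ℝ _).symm rfl))))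
  have key := (hΓ.lagrangian ⟨_, hp⟩ _).1 ⟨w₂, hw₂⟩ _ ⟨w₁, hw₁⟩
  have h0 := (Ω.twisted_apply g (𝒢.ε (𝒢.β g)) g _ _).symm.trans key
  have z1 : Ω g ![u, 0] = 0 := (Ω g).map_coord_zero 1 rfl
  have z2 : ∀ w : E, Ω (𝒢.ε (𝒢.β g)) ![(0 : E), w] = 0 := fun w ↦
    (Ω (𝒢.ε (𝒢.β g))).map_coord_zero 0 rfl
  have h1 : -Ω g ![u, 0] - Ω (𝒢.ε (𝒢.β g)) ![(0 : E), _] + Ω g ![u, v] = 0 := h0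
  rw [z1, z2] at h1
  simpa using h1

/-! ### Lagrangian submanifolds and orthogonal fibres -/

/-- If the fibres of `f₁` and `f₂` are symplectically orthogonal and the restriction of `f₁` to a
Lagrangian submanifold is a local diffeomorphism, then so is that of `f₂`. -/
theorem IsLagrangianSubmanifold.isLocalDiffeomorph_comp {E F V : Type*}
    [NormedAddCommGroup E] [NormedSpace ℝ E] [NormedAddCommGroup F] [NormedSpace ℝ F]
    [FiniteDimensional ℝ F] [NormedAddCommGroup V] [NormedSpace ℝ V] [FiniteDimensional ℝ V]
    {G : Type*} [TopologicalSpace G] [ChartedSpace E G] [IsManifold 𝓘(ℝ, E) ∞ G]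
    {P : Type*} [TopologicalSpace P] [ChartedSpace F P] [IsManifold 𝓘(ℝ, F) ∞ P]
    {S : Type*} [TopologicalSpace S] [ChartedSpace V S] [IsManifold 𝓘(ℝ, V) ∞ S]
    {Ω : TwoForm 𝓘(ℝ, E) G} (hΩ : IsSymplectic Ω) {ι : S → G}
    (hι : IsLagrangianSubmanifold 𝓘(ℝ, V) 𝓘(ℝ, E) Ω ι) {f₁ f₂ : G → P}
    (hf₁ : ContMDiff 𝓘(ℝ, E) 𝓘(ℝ, F) ∞ f₁) (hf₂ : ContMDiff 𝓘(ℝ, E) 𝓘(ℝ, F) ∞ f₂)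
    (horth : ∀ (g : G) (u v : TangentSpace 𝓘(ℝ, E) g), mfderiv 𝓘(ℝ, E) 𝓘(ℝ, F) f₁ g u = 0 →
      mfderiv 𝓘(ℝ, E) 𝓘(ℝ, F) f₂ g v = 0 → Ω g ![u, v] = 0)
    (h : IsLocalDiffeomorph 𝓘(ℝ, V) 𝓘(ℝ, F) ∞ (f₁ ∘ ι)) :
    IsLocalDiffeomorph 𝓘(ℝ, V) 𝓘(ℝ, F) ∞ (f₂ ∘ ι) := by
  intro s
  have hιs : ContMDiff 𝓘(ℝ, V) 𝓘(ℝ, E) ∞ ι := hι.immersion.contMDiff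
  have hιd := (hιs s).mdifferentiableAt (n := ∞) (by simp)
  set D := (h s).mfderivToContinuousLinearEquiv (by simp)
  have hD' : ∀ w, D w = mfderiv 𝓘(ℝ, E) 𝓘(ℝ, F) f₁ (ι s) (mfderiv 𝓘(ℝ, V) 𝓘(ℝ, E) ι s w) :=
    fun w ↦ mfderiv_comp_apply s ((hf₁ _).mdifferentiableAt (by simp)) hιd w
  have hinj : Function.Injective (mfderiv 𝓘(ℝ, V) 𝓘(ℝ, F) (f₂ ∘ ι) s) := by
    rw [injective_iff_map_eq_zero]
    intro w hw
    have hw' : mfderiv 𝓘(ℝ, E) 𝓘(ℝ, F) f₂ (ι s) (mfderiv 𝓘(ℝ, V) 𝓘(ℝ, E) ι s w) = 0 :=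
      (mfderiv_comp_apply s ((hf₂ _).mdifferentiableAt (by simp)) hιd w).symm.trans hw
    have hzero : mfderiv 𝓘(ℝ, V) 𝓘(ℝ, E) ι s w = 0 := by
      refine hΩ.nondegenerate _ _ fun x ↦ ?_
      rw [Ω.swap, neg_eq_zero]
      -- Surjectivity of `D` yields a tangent vector `z` of `S` with the same image as `x` under
      -- `Tf₁`; then `x - Tι z` lies in `ker Tf₁`.
      obtain ⟨z, hz⟩ := D.surjective (mfderiv 𝓘(ℝ, E) 𝓘(ℝ, F) f₁ (ι s) x)
      have hx : x = (x - mfderiv 𝓘(ℝ, V) 𝓘(ℝ, E) ι s z) + mfderiv 𝓘(ℝ, V) 𝓘(ℝ, E) ι s z := by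
        abel
      have h1 : Ω (ι s) ![x - mfderiv 𝓘(ℝ, V) 𝓘(ℝ, E) ι s z, mfderiv 𝓘(ℝ, V) 𝓘(ℝ, E) ι s w] = 0 :=
        horth _ _ _ (by rw [map_sub, ← hD', hz]; exact sub_self _) hw'
      have h2 := (hι.lagrangian s _).1 ⟨w, rfl⟩ _ ⟨z, rfl⟩
      rw [hx, (Ω (ι s)).vecCons_add, h1, h2, add_zero]
    -- `D` factors through `Tι`, so `Tι w = 0` forces `w = 0`.
    refine D.map_eq_zero_iff.1 ?_
    rw [hD', hzero]
    exact map_zero _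
  have hdim : Module.finrank ℝ V = Module.finrank ℝ F := D.toLinearEquiv.finrank_eq
  have hinj' : Function.Injective
      (show V →L[ℝ] F from mfderiv 𝓘(ℝ, V) 𝓘(ℝ, F) (f₂ ∘ ι) s).toLinearMap := hinj
  have : CompleteSpace V := FiniteDimensional.complete ℝ V
  have : CompleteSpace F := FiniteDimensional.complete ℝ F
  exact isLocalDiffeomorphAt_of_bijective_mfderiv (by simp) (hf₂.comp hιs)
    ⟨hinj, (LinearMap.injective_iff_surjective_of_finrank_eq_finrank hdim).1 hinj'⟩

end SymplecticGroupoid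

theorem theorem2p1 {d : ℕ} {E F V : Type*}
    [NormedAddCommGroup E] [NormedSpace ℝ E] [FiniteDimensional ℝ E]
    [NormedAddCommGroup F] [NormedSpace ℝ F] [FiniteDimensional ℝ F]
    [NormedAddCommGroup V] [NormedSpace ℝ V] [FiniteDimensional ℝ V]
    (hd : Module.finrank ℝ E = 2 * d)
    {G : Type*} [TopologicalSpace G] [ChartedSpace E G] [IsManifold 𝓘(ℝ, E) ∞ G]
    {P : Type*} [TopologicalSpace P] [ChartedSpace F P] [IsManifold 𝓘(ℝ, F) ∞ P]
    (𝒢 : SymplecticGroupoid.GroupoidOver G P)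
    (Ω : SymplecticGroupoid.TwoForm 𝓘(ℝ, E) G)
    (h𝒢 : SymplecticGroupoid.IsSymplecticGroupoid (F := F) 𝒢 Ω)
    {S : Type*} [TopologicalSpace S] [ChartedSpace V S] [IsManifold 𝓘(ℝ, V) ∞ S]
    (ι : S → G)
    (hι : SymplecticGroupoid.IsLagrangianSubmanifold 𝓘(ℝ, V) 𝓘(ℝ, E) Ω ι) :
    IsLocalDiffeomorph 𝓘(ℝ, V) 𝓘(ℝ, F) ∞ (𝒢.α ∘ ι) ↔
      IsLocalDiffeomorph 𝓘(ℝ, V) 𝓘(ℝ, F) ∞ (𝒢.β ∘ ι) := by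
  have hα := h𝒢.lie.submersion_α.contMDiff
  have hβ := h𝒢.lie.submersion_β.contMDiff
  refine ⟨hι.isLocalDiffeomorph_comp h𝒢.symplectic hα hβ fun g u v hu hv ↦ ?_,
    hι.isLocalDiffeomorph_comp h𝒢.symplectic hβ hα fun g u v hu hv ↦ h𝒢.apply_eq_zero hu hv⟩
  rw [Ω.swap, h𝒢.apply_eq_zero hv hu, neg_zero]
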